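/- Let $\Gamma$ be a countable group that has a quotient which is a non-abelian free group. A *tracial representation* of $\Gamma$ is a unitary representation $\pi:\Gamma\to\mathcal U(\mathcal H)$ on a Hilbert space together with a faithful normal tracial state $\tau$ on the von Neumann algebra $M_\pi=\pi(\Gamma)''$ generated by $\pi$ (normal: weak-operator continuous on the unit ball); its trace is the function $\chi_\pi=\tau\circ\pi$ on $\Gamma$. It is *amenable* if there is a state on $\mathcal B(\mathcal H)$ invariant under $T\mapsto \pi(g)T\pi(g)^*$ for all $g\in\Gamma$. For tracial representations $\pi,\rho$ and a finite set $S\subset\Gamma$ let $$W_{S}(\pi,\rho)=\inf\Big(\sum_{s\in S}\|a(s)-b(s)\|_2^2\Big)^{1/2},$$ where the infimum is over all realizations of $\pi$ and $\rho$ inside a common tracial von Neumann algebra, that is, over all von Neumann algebras $M$ with a faithful normal tracial state $\tau$ and homomorphisms $a,b:\Gamma\to\mathcal U(M)$ with $\tau\circ a=\chi_\pi$ and $\tau\circ b=\chi_\rho$, and where $\|x\|_2=\tau(x^*x)^{1/2}$. The *Wasserstein topology* on tracial representations is the topology defined by the distances $W_S$, $S\subset\Gamma$ finite (if $\Gamma$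 is finitely generated, one finite generating set $S$ suffices). Then the non-amenable tracial representations of $\Gamma$ are dense in the space of all tracial representations of $\Gamma$ with respect to the Wasserstein topology; that is, for every tracial representation $\pi$ of $\Gamma$, every finite set $S\subset\Gamma$ and every $\varepsilon>0$ there is a non-amenable tracial representation $\rho$ of $\Gamma$ with $W_S(\pi,\rho)<\varepsilon$. -/

import Mathlib

open scoped ENNReal ComplexOrder

universe u v

noncomputable section

namespace TracialReps

/-- A faithful normal tracial state on a von Neumann algebra `M` of operators on `H`: a positive,
normalized, faithful linear functional `τ` with `τ (x y) = τ (y x)` whose restriction to the unit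
ball of `M` is continuous for the weak operator topology. -/
structure FaithfulNormalTrace {H : Type u} [NormedAddCommGroup H] [InnerProductSpace ℂ H]
    [CompleteSpace H] (M : VonNeumannAlgebra H) where
  /-- the underlying linear functional -/
  τ : M.toStarSubalgebra →ₗ[ℂ] ℂ
  nonneg : ∀ x, 0 ≤ τ (star x * x)
  faithful : ∀ x, τ (star x * x) = 0 → x = 0
  map_one : τ 1 = 1
  trace_comm : ∀ x y, τ (x * y) = τ (y * x)
  normal : Continuous fun A : {A : H →WOT[ℂ] H //
      A.toCLM ∈ M.toStarSubalgebra ∧ ‖A.toCLM‖ ≤ 1} => τ ⟨A.1.toCLM, A.2.1⟩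

/-- The 2-norm `‖x‖₂ = τ(x* x)^{1/2}` of a tracial von Neumann algebra. -/
def FaithfulNormalTrace.norm₂ {H : Type u} [NormedAddCommGroup H] [InnerProductSpace ℂ H]
    [CompleteSpace H] {M : VonNeumannAlgebra H} (t : FaithfulNormalTrace M)
    (x : M.toStarSubalgebra) : ℝ :=
  Real.sqrt (t.τ (star x * x)).re

section Rep

variable {Γ : Type v} [Group Γ] {H : Type u} [NormedAddCommGroup H] [InnerProductSpace ℂ H]
  [CompleteSpace H]

/-- The commutant `π(Γ)'` of a unitary representation. -/
def repCommutant (π : Γ →* unitary (H →L[ℂ] H)) : VonNeumannAlgebra H where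
  toStarSubalgebra := StarSubalgebra.centralizer ℂ (Set.range fun g => (π g : H →L[ℂ] H))
  centralizer_centralizer' := by
    simp [StarSubalgebra.coe_centralizer]

/-- The von Neumann algebra `M_π = π(Γ)''` generated by a unitary representation, which is the
closure of the linear span of `π(Γ)` in the weak operator topology. -/
def repVonNeumann (π : Γ →* unitary (H →L[ℂ] H)) : VonNeumannAlgebra H :=
  (repCommutant π).commutant

theorem mem_repVonNeumann (π : Γ →* unitary (H →L[ℂ] H)) (g : Γ) :
    (π g : H →L[ℂ] H) ∈ (repVonNeumann π).toStarSubalgebra := by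
  change (π g : H →L[ℂ] H) ∈ (repCommutant π).commutant
  rw [VonNeumannAlgebra.mem_commutant_iff]
  intro z hz
  have hz' : z ∈ StarSubalgebra.centralizer ℂ (Set.range fun g => (π g : H →L[ℂ] H)) := hz
  rw [StarSubalgebra.mem_centralizer_iff] at hz'
  exact ((hz' _ ⟨g, rfl⟩).1).symm

/-- Amenability of a unitary representation in the sense of Bekka: there is a state on `B(H)` that
is invariant under the adjoint action `T ↦ π(g) T π(g)*`. -/
def IsAmenableRep (π : Γ →* unitary (H →L[ℂ] H)) : Prop :=
  ∃ φ : (H →L[ℂ] H) →ₗ[ℂ] ℂ, (∀ T, 0 ≤ φ (star T * T)) ∧ φ 1 = 1 ∧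
    ∀ (g : Γ) (T : H →L[ℂ] H), φ ((π g : H →L[ℂ] H) * T * star (π g : H →L[ℂ] H)) = φ T

end Rep

/-- A tracial representation of `Γ`: a unitary representation `π` on a Hilbert space together with
a faithful normal tracial state on the von Neumann algebra `M_π` that it generates. -/
structure TracialRep (Γ : Type v) [Group Γ] where
  /-- the Hilbert space -/
  H : Type u
  [normedAddCommGroup : NormedAddCommGroup H]
  [innerProductSpace : InnerProductSpace ℂ H]
  [completeSpace : CompleteSpace H]
  /-- the unitary representation -/
  π : Γ →* unitary (H →L[ℂ] H)
  /-- the trace on `M_π` -/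
  trace : FaithfulNormalTrace (repVonNeumann π)

attribute [instance] TracialRep.normedAddCommGroup TracialRep.innerProductSpace
  TracialRep.completeSpace

variable {Γ : Type v} [Group Γ]

/-- The trace `χ_π(g) = τ(π(g))` on the group. -/
def TracialRep.χ (p : TracialRep.{u} Γ) (g : Γ) : ℂ :=
  p.trace.τ ⟨p.π g, mem_repVonNeumann p.π g⟩

/-- Amenability (in the sense of Bekka) of a tracial representation. -/
def TracialRep.IsAmenable (p : TracialRep.{u} Γ) : Prop := IsAmenableRep p.π

/-- A realization of two tracial representations `p`, `q` of `Γ` inside a common tracial von Neumann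
algebra `(M, τ)`: homomorphisms `a`, `b` from `Γ` to the unitary group of `M` with
`τ ∘ a = χ_p` and `τ ∘ b = χ_q`. (The equality of traces says exactly that `p.π g ↦ a g` extends to
a normal trace preserving embedding of the von Neumann algebra of `p` into `M`; same for `q`.) -/
structure CommonRealization (p q : TracialRep.{u} Γ) where
  /-- the Hilbert space on which `M` acts -/
  K : Type u
  [normedAddCommGroup : NormedAddCommGroup K]
  [innerProductSpace : InnerProductSpace ℂ K]
  [completeSpace : CompleteSpace K]
  /-- the common von Neumann algebra -/
  M : VonNeumannAlgebra K
  /-- its trace -/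
  trace : FaithfulNormalTrace M
  /-- the copy of the first representation -/
  a : Γ →* unitary M.toStarSubalgebra
  /-- the copy of the second representation -/
  b : Γ →* unitary M.toStarSubalgebra
  trace_a : ∀ g, trace.τ (a g : M.toStarSubalgebra) = p.χ g
  trace_b : ∀ g, trace.τ (b g : M.toStarSubalgebra) = q.χ g

attribute [instance] CommonRealization.normedAddCommGroup CommonRealization.innerProductSpace
  CommonRealization.completeSpace

/-- The Wasserstein distance of two tracial representations with respect to a finite set `S` of
group elements: the infimum of `(∑_{s ∈ S} ‖a s - b s‖₂²)^{1/2}` over all realizations inside a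
common tracial von Neumann algebra (with values in `[0, ∞]`). -/
def wasserstein (S : Finset Γ) (p q : TracialRep.{u} Γ) : ℝ≥0∞ :=
  ⨅ c : CommonRealization p q, ENNReal.ofReal
    (Real.sqrt (∑ s ∈ S, c.trace.norm₂ ((c.a s : c.M.toStarSubalgebra) - c.b s) ^ 2))

theorem wasserstein_mono {S T : Finset Γ} (h : S ⊆ T) (p q : TracialRep.{u} Γ) :
    wasserstein S p q ≤ wasserstein T p q :=
  iInf_mono fun _ => ENNReal.ofReal_le_ofReal (Real.sqrt_le_sqrt
    (Finset.sum_le_sum_of_subset_of_nonneg h fun _ _ _ => sq_nonneg _))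

/-- The Wasserstein topology on tracial representations: a set is open if around each of its points
it contains a ball for the Wasserstein distance of some finite set `S ⊆ Γ`. If `Γ` is generated by
a finite set `S₀`, this is the topology of the single distance for `S₀`. -/
instance wassersteinTopology : TopologicalSpace (TracialRep.{u} Γ) where
  IsOpen U := ∀ p ∈ U, ∃ S : Finset Γ, ∃ ε : ℝ≥0∞, 0 < ε ∧ ∀ q, wasserstein S p q < ε → q ∈ U
  isOpen_univ := fun _ _ => ⟨∅, 1, one_pos, fun _ _ => trivial⟩
  isOpen_inter := by
    classical
    rintro U V hU hV p ⟨hpU, hpV⟩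
    obtain ⟨S, ε, hε, hS⟩ := hU p hpU
    obtain ⟨T, δ, hδ, hT⟩ := hV p hpV
    refine ⟨S ∪ T, min ε δ, lt_min hε hδ, fun q hq => ⟨hS q ?_, hT q ?_⟩⟩
    · exact (wasserstein_mono Finset.subset_union_left p q).trans_lt
        (hq.trans_le (min_le_left _ _))
    · exact (wasserstein_mono Finset.subset_union_right p q).trans_lt
        (hq.trans_le (min_le_right _ _))
  isOpen_sUnion := by
    rintro 𝒰 h p ⟨U, hU, hp⟩
    obtain ⟨S, ε, hε, hS⟩ := h U hU p hp
    exact ⟨S, ε, hε, fun q hq => ⟨U, hU, hS q hq⟩⟩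

end TracialReps

end

/-!
Let `Γ` map onto a free group with at least two generators, and let `p` be a tracial representation
with von Neumann algebra `M`. The approximating representations are tensor products
`g ↦ π(g) ⊗ σ_θ(g)`, where `σ_θ` factors through the free group, takes values in the unitaries of a
group von Neumann algebra `L(G)`, and tends to the trivial representation as `θ → 0`. Since
`M ⊗ L(G)` contains both `π ⊗ 1` and `π ⊗ σ_θ`, the Wasserstein distances tend to zero
(`tendsto_wasserstein_perturbedHom`). Two points need care: tensor products of tracial von Neumann
algebras, and the choice of `σ_θ`.

*Tensor product.* On `ℓ²(G, H)`, the operators commuting with `M' ⊗ 1` and with the right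
translations form the von Neumann algebra `groupTensor G M`. Their matrix entries lie in `M` and are
constant along right diagonals. Taking the trace of the entry at `(1, 1)` gives a faithful normal
trace: by normality of the trace on `M`, the trace of a product is the sum of the traces of products
of matrix entries (`FaithfulNormalTrace.hasSum_entryIn`), and faithfulness and the trace property can
be read off that sum.

*Choice of `σ_θ`.* Suppose `φ` is a state invariant under `π ⊗ σ_θ`. On the commutant of `π ⊗ 1` it is
invariant under `σ_θ`, so there the elements `X` with `φ(X T) = φ(T X)` for all `T` form an algebra
containing the image of `σ_θ`. Now let `s`, `t` be elements of `G` of orders two and three and `A` a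
subset of `G` such that `A ⊔ s A = G` and `A ⊔ t A ⊔ t² A = G`. If the translations by `s` and `t`
lie in the algebra generated by the image of `σ_θ`, then `φ` takes the values `1/2` and `1/3` on the
indicator of `A`, which is absurd (`IsTwoThreeParadox.not_isAmenableRep`). Such `s`, `t`, `A` exist in
the permutation group of `ℕ`. It remains to generate `s` and `t` from unitaries close to one. A
self-adjoint `k` with `k³ = k` has the exponential
`exp (i θ k) = 1 + (cos θ - 1) k² + i sin θ k`, from which `k` is recovered by subtracting the adjoint
as soon as `sin θ ≠ 0`. For `k = s` this gives `s` back; for `k = (i / √3) (t - t²)` it gives `t`,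
which is a quadratic polynomial in `k`. So `σ_θ` sends one free generator to `exp (i θ k)` for the
first `k` and all others to `exp (i θ k)` for the second.
-/

universe w

noncomputable section

namespace TracialReps

open Filter Topology

/-- The Hilbert space `ℓ²(G, H) = ℓ²(G) ⊗ H` of square summable families of vectors of `H`. -/
abbrev Ell2 (G : Type w) (H : Type u) [NormedAddCommGroup H] : Type (max w u) :=
  lp (fun _ : G => H) 2

/-! ### Operators on square summable families -/

section Operators

variable {G : Type w} {H : Type u} [NormedAddCommGroup H]

theorem summable_sq_norm (ξ : Ell2 G H) : Summable fun x => ‖ξ x‖ ^ 2 := by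
  simpa using (lp.memℓp ξ).summable (by norm_num)

theorem sq_norm_eq_tsum (ξ : Ell2 G H) : ‖ξ‖ ^ 2 = ∑' x, ‖ξ x‖ ^ 2 := by
  simpa using lp.norm_rpow_eq_tsum (p := 2) (by norm_num) ξ

variable [InnerProductSpace ℂ H]

theorem summable_sq_norm_weighted (e : Equiv.Perm G) {c : G → H →L[ℂ] H} {C : ℝ}
    (hc : ∀ x, ‖c x‖ ≤ C) (ξ : Ell2 G H) : Summable fun x => ‖c x (ξ (e⁻¹ x))‖ ^ 2 := by
  refine Summable.of_nonneg_of_le (fun _ => by positivity) (fun x => ?_)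
    (((e⁻¹).summable_iff.2 (summable_sq_norm ξ)).mul_left (C ^ 2))
  rw [Function.comp_apply, ← mul_pow]
  gcongr
  exact (c x).le_of_opNorm_le (hc x) _

/-- The operator `(T ξ) x = c x (ξ (e⁻¹ x))` on `ℓ²(G, H)`, for a bounded family `c` of operators
on `H` and a permutation `e` of `G`. -/
def weightedShift (e : Equiv.Perm G) (c : G → H →L[ℂ] H) (C : ℝ) (hc : ∀ x, ‖c x‖ ≤ C) :
    Ell2 G H →L[ℂ] Ell2 G H :=
  LinearMap.mkContinuous
    { toFun := fun ξ => ⟨fun x => c x (ξ (e⁻¹ x)), memℓp_gen (by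
        simpa using! summable_sq_norm_weighted e hc ξ)⟩
      map_add' := fun ξ η => by ext x; exact map_add (c x) _ _
      map_smul' := fun a ξ => by ext x; simp } (max C 0) <| fun ξ => by
    refine (sq_le_sq₀ (norm_nonneg _) (by positivity)).1 ?_
    rw [sq_norm_eq_tsum, mul_pow, sq_norm_eq_tsum, ← tsum_mul_left,
      ← (e⁻¹).tsum_eq fun x => max C 0 ^ 2 * ‖ξ x‖ ^ 2]
    refine Summable.tsum_le_tsum (fun x => ?_) (summable_sq_norm_weighted e hc ξ)
      (((e⁻¹).summable_iff.2 (summable_sq_norm ξ)).mul_left _)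
    rw [← mul_pow]
    exact pow_le_pow_left₀ (norm_nonneg _)
      ((c x).le_of_opNorm_le ((hc x).trans (le_max_left _ _)) _) 2

theorem weightedShift_apply (e : Equiv.Perm G) (c : G → H →L[ℂ] H) (C : ℝ)
    (hc : ∀ x, ‖c x‖ ≤ C) (ξ : Ell2 G H) (x : G) :
    weightedShift e c C hc ξ x = c x (ξ (e⁻¹ x)) := rfl

/-- The amplification `1 ⊗ T` on `ℓ²(G) ⊗ H` of an operator `T` on `H`. -/
def amp (G : Type w) (T : H →L[ℂ] H) : Ell2 G H →L[ℂ] Ell2 G H :=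
  weightedShift 1 (fun _ => T) ‖T‖ fun _ => le_rfl

/-- The permutation operator `(shift e ξ) x = ξ (e⁻¹ x)`. -/
def shift (H : Type u) [NormedAddCommGroup H] [InnerProductSpace ℂ H] (e : Equiv.Perm G) :
    Ell2 G H →L[ℂ] Ell2 G H :=
  weightedShift e (fun _ => 1) 1 fun _ => ContinuousLinearMap.norm_id_le

open Classical in
/-- Multiplication by the indicator function of `A`. -/
def cutoff (H : Type u) [NormedAddCommGroup H] [InnerProductSpace ℂ H] (A : Set G) :
    Ell2 G H →L[ℂ] Ell2 G H :=
  weightedShift 1 (fun x => if x ∈ A then 1 else 0) 1 fun x => by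
    split_ifs
    · exact ContinuousLinearMap.norm_id_le
    · simp

@[simp]
theorem amp_apply (T : H →L[ℂ] H) (ξ : Ell2 G H) (x : G) : amp G T ξ x = T (ξ x) := rfl

@[simp]
theorem shift_apply (e : Equiv.Perm G) (ξ : Ell2 G H) (x : G) : shift H e ξ x = ξ (e⁻¹ x) := rfl

open Classical in
theorem cutoff_apply (A : Set G) (ξ : Ell2 G H) (x : G) :
    cutoff H A ξ x = if x ∈ A then ξ x else 0 := by
  rw [cutoff, weightedShift_apply]
  split_ifs <;> rfl

theorem shift_one : shift H (1 : Equiv.Perm G) = 1 := rfl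

theorem shift_mul (e f : Equiv.Perm G) : shift H (e * f) = shift H e * shift H f := by
  ext ξ x; rfl

theorem shift_mulLeft_one {G : Type w} [Group G] : shift H (Equiv.mulLeft (1 : G)) = 1 := by
  rw [← shift_one]
  congr 1
  ext; simp

theorem shift_mulLeft_mul {G : Type w} [Group G] (s t : G) :
    shift H (Equiv.mulLeft (s * t)) = shift H (Equiv.mulLeft s) * shift H (Equiv.mulLeft t) := by
  rw [← shift_mul]
  congr 1
  ext; simp

theorem amp_one : amp G (1 : H →L[ℂ] H) = 1 := rfl

theorem amp_mul (S T : H →L[ℂ] H) : amp G (S * T) = amp G S * amp G T := by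
  ext ξ x; rfl

theorem amp_mul_shift (T : H →L[ℂ] H) (e : Equiv.Perm G) :
    amp G T * shift H e = shift H e * amp G T := by
  ext ξ x; rfl

theorem amp_mul_cutoff (T : H →L[ℂ] H) (A : Set G) :
    amp G T * cutoff H A = cutoff H A * amp G T := by
  classical
  ext ξ x
  simp only [mul_apply_eq_comp, amp_apply, cutoff_apply]
  split_ifs <;> simp

section Complete

variable [CompleteSpace H]

theorem star_amp (T : H →L[ℂ] H) : star (amp G T) = amp G (star T) := by
  refine ((ContinuousLinearMap.eq_adjoint_iff _ _).2 fun ξ η => ?_).symm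
  simp [lp.inner_eq_tsum, ContinuousLinearMap.star_eq_adjoint,
    ContinuousLinearMap.adjoint_inner_left]

theorem star_shift (e : Equiv.Perm G) : star (shift H e) = shift H e⁻¹ := by
  refine ((ContinuousLinearMap.eq_adjoint_iff _ _).2 fun ξ η => ?_).symm
  simp only [lp.inner_eq_tsum, shift_apply, inv_inv]
  rw [← e.tsum_eq fun x => inner ℂ (ξ x) (η (e⁻¹ x))]
  simp

end Complete

end Operators

/-! ### Matrix entries of operators on square summable families -/

section Entries

variable {G : Type w} {H : Type u} [NormedAddCommGroup H] [InnerProductSpace ℂ H]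

open Classical in
/-- The inclusion of `H` into `ℓ²(G, H)` as the summand at `x`. -/
def incl (x : G) : H →L[ℂ] Ell2 G H := lp.singleContinuousLinearMap ℂ (fun _ : G => H) 2 x

open Classical in
theorem incl_apply (x : G) (h : H) : incl x h = lp.single (E := fun _ : G => H) 2 x h := rfl

theorem norm_incl (x : G) (h : H) : ‖incl x h‖ = ‖h‖ := by
  classical
  exact lp.norm_single (p := 2) (E := fun _ : G => H) (by norm_num) x h

/-- The matrix entry `T_{x,y}` of an operator on `ℓ²(G, H)`. -/
def entry (T : Ell2 G H →L[ℂ] Ell2 G H) (x y : G) : H →L[ℂ] H :=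
  lp.evalCLM ℂ (fun _ : G => H) 2 x ∘L T ∘L incl y

theorem entry_apply (T : Ell2 G H →L[ℂ] Ell2 G H) (x y : G) (h : H) :
    entry T x y h = T (incl y h) x := rfl

theorem entry_add (S T : Ell2 G H →L[ℂ] Ell2 G H) (x y : G) :
    entry (S + T) x y = entry S x y + entry T x y := by
  ext h; simp [entry_apply]

theorem entry_smul (c : ℂ) (T : Ell2 G H →L[ℂ] Ell2 G H) (x y : G) :
    entry (c • T) x y = c • entry T x y := by
  ext h; simp [entry_apply]

theorem norm_entry_apply_le (T : Ell2 G H →L[ℂ] Ell2 G H) (x y : G) (h : H) :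
    ‖entry T x y h‖ ≤ ‖T‖ * ‖h‖ := by
  rw [entry_apply, ← norm_incl y h]
  exact (lp.norm_apply_le_norm (by norm_num) _ _).trans (T.le_opNorm _)

theorem norm_entry_le (T : Ell2 G H →L[ℂ] Ell2 G H) (x y : G) : ‖entry T x y‖ ≤ ‖T‖ :=
  ContinuousLinearMap.opNorm_le_bound _ (norm_nonneg T) (norm_entry_apply_le T x y)

theorem hasSum_incl (ξ : Ell2 G H) : HasSum (fun x => incl x (ξ x)) ξ := by
  classical
  simpa only [incl_apply] using! lp.hasSum_single (by norm_num) ξ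

theorem norm_sum_incl_le (ξ : Ell2 G H) (F : Finset G) : ‖∑ x ∈ F, incl x (ξ x)‖ ≤ ‖ξ‖ := by
  classical
  refine (sq_le_sq₀ (norm_nonneg _) (norm_nonneg _)).1 ?_
  have h1 := lp.norm_sum_single (p := 2) (E := fun _ : G => H) (by norm_num) (fun x => ξ x) F
  have h2 := lp.sum_rpow_le_norm_rpow (p := 2) (E := fun _ : G => H) (by norm_num) ξ F
  rw [← h1] at h2
  simpa using! h2

theorem sum_entry_mul_entry_apply (S T : Ell2 G H →L[ℂ] Ell2 G H) (y z : G) (F : Finset G)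
    (h : H) : (∑ x ∈ F, entry S y x * entry T x z) h =
      S (∑ x ∈ F, incl x (T (incl z h) x)) y := by
  rw [map_sum, lp.coeFn_sum, Finset.sum_apply]
  simp [entry_apply]

theorem tendsto_sum_entry_mul_entry (S T : Ell2 G H →L[ℂ] Ell2 G H) (y z : G) (h : H) :
    Tendsto (fun F : Finset G => (∑ x ∈ F, entry S y x * entry T x z) h) atTop
      (𝓝 (entry (S * T) y z h)) := by
  simp only [sum_entry_mul_entry_apply]
  exact ((lp.evalCLM ℂ (fun _ : G => H) 2 y ∘L S).continuous.tendsto _).comp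
    (hasSum_incl (T (incl z h)))

theorem norm_sum_entry_mul_entry_le (S T : Ell2 G H →L[ℂ] Ell2 G H) (y z : G) (F : Finset G) :
    ‖∑ x ∈ F, entry S y x * entry T x z‖ ≤ ‖S‖ * ‖T‖ := by
  refine ContinuousLinearMap.opNorm_le_bound _ (by positivity) fun h => ?_
  rw [sum_entry_mul_entry_apply, mul_assoc]
  refine (lp.norm_apply_le_norm (by norm_num) _ _).trans (S.le_opNorm_of_le ?_)
  refine (norm_sum_incl_le _ F).trans ?_
  rw [← norm_incl z h]
  exact T.le_opNorm _

theorem shift_incl (e : Equiv.Perm G) (x : G) (h : H) : shift H e (incl x h) = incl (e x) h := by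
  classical
  ext y
  by_cases hy : y = e x
  · subst hy; simp [incl_apply]
  · have : e⁻¹ y ≠ x := fun h' => hy (by simp [← h'])
    simp only [shift_apply, incl_apply, lp.single_apply_ne _ _ _ this, lp.single_apply_ne _ _ _ hy]

theorem amp_incl (T : H →L[ℂ] H) (x : G) (h : H) : amp G T (incl x h) = incl x (T h) := by
  classical
  ext y
  by_cases hy : y = x
  · subst hy; simp [incl_apply]
  · simp only [amp_apply, incl_apply, lp.single_apply_ne _ _ _ hy, map_zero]

theorem entry_amp_self (T : H →L[ℂ] H) (x : G) : entry (amp G T) x x = T := by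
  classical
  ext h
  rw [entry_apply, amp_incl, incl_apply, lp.single_apply_self]

theorem entry_one_self (x : G) : entry (1 : Ell2 G H →L[ℂ] Ell2 G H) x x = 1 :=
  entry_amp_self 1 x

theorem entry_star [CompleteSpace H] (T : Ell2 G H →L[ℂ] Ell2 G H) (x y : G) :
    entry (star T) x y = star (entry T y x) := by
  classical
  refine (ContinuousLinearMap.eq_adjoint_iff _ _).2 fun a b => ?_
  have h1 := lp.inner_single_left (𝕜 := ℂ) (G := fun _ : G => H) y a (T (incl x b))
  have h2 := lp.inner_single_right (𝕜 := ℂ) (G := fun _ : G => H) x b (star T (incl y a))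
  rw [entry_apply, entry_apply, ← h1, ← h2, ContinuousLinearMap.star_eq_adjoint,
    ContinuousLinearMap.adjoint_inner_left]
  rfl

theorem ext_entry {T : Ell2 G H →L[ℂ] Ell2 G H} (h : ∀ x y, entry T x y = 0) : T = 0 := by
  ext ξ x
  refine ((lp.evalCLM ℂ (fun _ : G => H) 2 x ∘L T).hasSum (hasSum_incl ξ)).unique ?_
  change HasSum (fun y => entry T x y (ξ y)) 0
  simp [h]

end Entries

/-! ### The tensor product with a group von Neumann algebra and its trace -/

section Trace

variable {H : Type u} [NormedAddCommGroup H] [InnerProductSpace ℂ H] [CompleteSpace H]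

namespace FaithfulNormalTrace

variable {M : VonNeumannAlgebra H}

/-- A normal trace is continuous along bounded strongly convergent nets. -/
theorem tendsto (t : FaithfulNormalTrace M) {α : Type*} {l : Filter α}
    {A : α → M.toStarSubalgebra} {B : M.toStarSubalgebra} {C : ℝ}
    (hA : ∀ i, ‖(A i : H →L[ℂ] H)‖ ≤ C)
    (hAB : ∀ h, Tendsto (fun i => (A i : H →L[ℂ] H) h) l (𝓝 ((B : H →L[ℂ] H) h))) :
    Tendsto (fun i => t.τ (A i)) l (𝓝 (t.τ B)) := by
  -- normality is continuity on the unit ball, so everything is scaled into it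
  set D : ℝ := max C ‖(B : H →L[ℂ] H)‖ + 1
  have hD0 : 0 < D := by positivity
  have hball : ∀ X : H →L[ℂ] H, ‖X‖ ≤ D → ‖((D⁻¹ : ℝ) : ℂ) • X‖ ≤ 1 := by
    intro X hX
    rw [norm_smul, Complex.norm_real, Real.norm_of_nonneg (by positivity),
      inv_mul_le_one₀ hD0]
    exact hX
  have hAD : ∀ i, ‖(A i : H →L[ℂ] H)‖ ≤ D := fun i =>
    (hA i).trans ((le_max_left _ _).trans (le_add_of_nonneg_right zero_le_one))
  have hBD : ‖(B : H →L[ℂ] H)‖ ≤ D := (le_max_right _ _).trans (le_add_of_nonneg_right zero_le_one)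
  let a : α → {A : H →WOT[ℂ] H // A.toCLM ∈ M.toStarSubalgebra ∧ ‖A.toCLM‖ ≤ 1} := fun i =>
    ⟨.ofCLM (((D⁻¹ : ℝ) : ℂ) • (A i : H →L[ℂ] H)),
      M.toStarSubalgebra.smul_mem (A i).2 _, hball _ (hAD i)⟩
  let b : {A : H →WOT[ℂ] H // A.toCLM ∈ M.toStarSubalgebra ∧ ‖A.toCLM‖ ≤ 1} :=
    ⟨.ofCLM (((D⁻¹ : ℝ) : ℂ) • (B : H →L[ℂ] H)),
      M.toStarSubalgebra.smul_mem B.2 _, hball _ hBD⟩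
  have hab : Tendsto a l (𝓝 b) := by
    rw [tendsto_subtype_rng, ContinuousLinearMapWOT.tendsto_iff_forall_dual_apply_tendsto]
    intro h y
    exact (y.continuous.tendsto _).comp ((hAB h).const_smul _)
  have key := ((t.normal.tendsto b).comp hab).const_mul ((D : ℝ) : ℂ)
  have hscale : ∀ X : M.toStarSubalgebra, ∀ hX,
      (D : ℂ) * t.τ ⟨((D⁻¹ : ℝ) : ℂ) • (X : H →L[ℂ] H), hX⟩ = t.τ X := by
    intro X hX
    have : (⟨((D⁻¹ : ℝ) : ℂ) • (X : H →L[ℂ] H), hX⟩ : M.toStarSubalgebra) =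
      ((D⁻¹ : ℝ) : ℂ) • X := rfl
    rw [this, map_smul, smul_eq_mul, ← mul_assoc, ← Complex.ofReal_mul,
      mul_inv_cancel₀ hD0.ne', Complex.ofReal_one, one_mul]
  have hB := hscale B b.2.1
  rw [← hB]
  exact key.congr fun i => hscale (A i) (a i).2.1

/-- The restriction of a faithful normal tracial state to a von Neumann subalgebra. -/
def restrict (t : FaithfulNormalTrace M) {N : VonNeumannAlgebra H}
    (h : N.toStarSubalgebra ≤ M.toStarSubalgebra) : FaithfulNormalTrace N where
  τ := t.τ ∘ₗ (StarSubalgebra.inclusion h).toAlgHom.toLinearMap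
  nonneg x := t.nonneg (StarSubalgebra.inclusion h x)
  faithful x hx := StarSubalgebra.inclusion_injective h <| by
    rw [map_zero]
    exact t.faithful (StarSubalgebra.inclusion h x) hx
  map_one := t.map_one
  trace_comm x y := t.trace_comm (StarSubalgebra.inclusion h x) (StarSubalgebra.inclusion h y)
  normal := t.normal.comp
    (f := fun A : {A : H →WOT[ℂ] H // A.toCLM ∈ N.toStarSubalgebra ∧ ‖A.toCLM‖ ≤ 1} =>
      (⟨A.1, h A.2.1, A.2.2⟩ :
        {A : H →WOT[ℂ] H // A.toCLM ∈ M.toStarSubalgebra ∧ ‖A.toCLM‖ ≤ 1}))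
    (continuous_subtype_val.subtype_mk _)

end FaithfulNormalTrace

variable (G : Type w) [Group G]

/-- The operators on `ℓ²(G, H)` that commute with the amplified commutant of `M` and with the right
translations: the von Neumann algebra tensor product of `M` and the left group von Neumann algebra
of `G`. -/
def groupTensor (M : VonNeumannAlgebra H) : VonNeumannAlgebra (Ell2 G H) where
  toStarSubalgebra := StarSubalgebra.centralizer ℂ
    (amp G '' (M.commutant : Set (H →L[ℂ] H)) ∪ Set.range fun r : G => shift H (Equiv.mulRight r))
  centralizer_centralizer' := by
    simp [StarSubalgebra.coe_centralizer]

variable {G} {M : VonNeumannAlgebra H}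

theorem mem_groupTensor_iff {T : Ell2 G H →L[ℂ] Ell2 G H} :
    T ∈ (groupTensor G M).toStarSubalgebra ↔
      (∀ x ∈ M.commutant, amp G x * T = T * amp G x) ∧
      ∀ r : G, shift H (Equiv.mulRight r) * T = T * shift H (Equiv.mulRight r) := by
  change T ∈ StarSubalgebra.centralizer ℂ _ ↔ _
  rw [StarSubalgebra.mem_centralizer_iff]
  constructor
  · exact fun h => ⟨fun x hx => (h _ (.inl ⟨x, hx, rfl⟩)).1, fun r => (h _ (.inr ⟨r, rfl⟩)).1⟩
  · rintro ⟨h₁, h₂⟩ _ (⟨x, hx, rfl⟩ | ⟨r, rfl⟩)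
    · exact ⟨h₁ x hx, by rw [star_amp]; exact h₁ _ (star_mem hx)⟩
    · refine ⟨h₂ r, ?_⟩
      have : (Equiv.mulRight r)⁻¹ = Equiv.mulRight r⁻¹ := by ext; simp
      rw [star_shift, this]
      exact h₂ r⁻¹

theorem entry_mem {T : Ell2 G H →L[ℂ] Ell2 G H} (hT : T ∈ (groupTensor G M).toStarSubalgebra)
    (x y : G) : entry T x y ∈ M.toStarSubalgebra := by
  change entry T x y ∈ M
  rw [← M.commutant_commutant, VonNeumannAlgebra.mem_commutant_iff]
  intro z hz
  ext h
  have := congr((($((mem_groupTensor_iff.1 hT).1 z hz)) (incl y h)) x)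
  simpa [entry_apply, amp_incl] using this

/-- The matrix of an operator that commutes with the right translations is constant along the
right diagonals. -/
theorem entry_mul_right {T : Ell2 G H →L[ℂ] Ell2 G H}
    (hT : T ∈ (groupTensor G M).toStarSubalgebra) (x y r : G) :
    entry T (x * r) (y * r) = entry T x y := by
  ext h
  have := congr((($((mem_groupTensor_iff.1 hT).2 r)) (incl y h)) (x * r))
  simpa [entry_apply, shift_incl] using this.symm

theorem amp_mem {T : H →L[ℂ] H} (hT : T ∈ M.toStarSubalgebra) :
    amp G T ∈ (groupTensor G M).toStarSubalgebra :=
  mem_groupTensor_iff.2 ⟨fun x hx => by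
    rw [← amp_mul, ← amp_mul, VonNeumannAlgebra.mem_commutant_iff.1 hx T hT], fun _ => (amp_mul_shift T _).symm⟩

theorem shift_mulLeft_mem (s : G) :
    shift H (Equiv.mulLeft s) ∈ (groupTensor G M).toStarSubalgebra :=
  mem_groupTensor_iff.2 ⟨fun z _ => amp_mul_shift z _, fun r => by
    rw [← shift_mul, ← shift_mul]
    congr 1
    ext; simp [mul_assoc]⟩

/-- The matrix entry of an element of `groupTensor G M`, as an element of `M`. -/
def entryIn (T : (groupTensor G M).toStarSubalgebra) (x y : G) : M.toStarSubalgebra :=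
  ⟨entry T.1 x y, entry_mem T.2 x y⟩

namespace FaithfulNormalTrace

variable (t : FaithfulNormalTrace M)

theorem hasSum_entryIn (S T : (groupTensor G M).toStarSubalgebra) (y z : G) :
    HasSum (fun x => t.τ (entryIn S y x * entryIn T x z)) (t.τ (entryIn (S * T) y z)) := by
  have := t.tendsto (l := atTop) (A := fun F : Finset G => ∑ x ∈ F, entryIn S y x * entryIn T x z)
    (B := entryIn (S * T) y z) (C := ‖S.1‖ * ‖T.1‖) (fun F => by
      rw [AddSubmonoidClass.coe_finsetSum]
      exact norm_sum_entry_mul_entry_le _ _ _ _ _) (fun h => by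
      simp only [AddSubmonoidClass.coe_finsetSum]
      exact tendsto_sum_entry_mul_entry _ _ _ _ _)
  simpa only [map_sum] using! this

theorem entryIn_star (T : (groupTensor G M).toStarSubalgebra) (x y : G) :
    entryIn (star T) x y = star (entryIn T y x) :=
  Subtype.ext (entry_star T.1 x y)

theorem hasSum_star_entryIn (T : (groupTensor G M).toStarSubalgebra) :
    HasSum (fun x => t.τ (star (entryIn T x 1) * entryIn T x 1))
      (t.τ (entryIn (star T * T) 1 1)) := by
  simpa only [entryIn_star] using t.hasSum_entryIn (star T) T 1 1

variable (G) in
/-- The tensor product of a trace on `M` with the canonical trace of the group von Neumann algebra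
of `G`: the trace of the diagonal matrix entry. -/
def groupTensor : FaithfulNormalTrace (groupTensor G M) where
  τ :=
    { toFun := fun T => t.τ (entryIn T 1 1)
      map_add' := fun S T => by
        rw [← map_add]; exact congrArg t.τ (Subtype.ext (entry_add S.1 T.1 1 1))
      map_smul' := fun c T => by
        rw [RingHom.id_apply, ← map_smul]
        exact congrArg t.τ (Subtype.ext (entry_smul c T.1 1 1)) }
  nonneg T := (t.hasSum_star_entryIn T).nonneg fun x => t.nonneg _
  faithful T hT := by
    have h0 := t.hasSum_star_entryIn T
    have hT' : t.τ (entryIn (star T * T) 1 1) = 0 := hT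
    rw [hT', hasSum_zero_iff_of_nonneg fun x => t.nonneg _] at h0
    refine Subtype.ext (ext_entry fun x y => ?_)
    have := congrArg Subtype.val (t.faithful _ (congrFun h0 (x * y⁻¹)))
    rw [← entry_mul_right T.2 x y y⁻¹, mul_inv_cancel]
    exact this
  map_one := by
    rw [← t.map_one]
    exact congrArg t.τ (Subtype.ext (entry_one_self 1))
  trace_comm S T := by
    refine (t.hasSum_entryIn S T 1 1).unique ?_
    rw [← (Equiv.inv G).hasSum_iff]
    refine (t.hasSum_entryIn T S 1 1).congr_fun fun x => ?_
    -- translating by `x` turns the entries at `(1, x⁻¹)` and `(x⁻¹, 1)` into those at `(x, 1)`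
    -- and `(1, x)`
    have h₁ : entryIn S 1 x⁻¹ = entryIn S x 1 := Subtype.ext <| by
      have := entry_mul_right S.2 1 x⁻¹ x
      rw [one_mul, inv_mul_cancel] at this
      exact this.symm
    have h₂ : entryIn T x⁻¹ 1 = entryIn T 1 x := Subtype.ext <| by
      have := entry_mul_right T.2 x⁻¹ 1 x
      rw [one_mul, inv_mul_cancel] at this
      exact this.symm
    simp only [Function.comp_apply, Equiv.inv_apply, h₁, h₂, t.trace_comm (entryIn S x 1)]
  normal := by
    refine t.normal.comp
      (f := fun A : {A : Ell2 G H →WOT[ℂ] Ell2 G H //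
          A.toCLM ∈ (TracialReps.groupTensor G M).toStarSubalgebra ∧ ‖A.toCLM‖ ≤ 1} =>
        (⟨.ofCLM (entry A.1.toCLM 1 1), entry_mem A.2.1 1 1, (norm_entry_le _ _ _).trans A.2.2⟩ :
          {A : H →WOT[ℂ] H // A.toCLM ∈ M.toStarSubalgebra ∧ ‖A.toCLM‖ ≤ 1}))
      (Continuous.subtype_mk ?_ _)
    refine ContinuousLinearMapWOT.continuous_of_dual_apply_continuous fun h y => ?_
    exact (ContinuousLinearMapWOT.continuous_dual_apply (incl 1 h)
      (y ∘L lp.evalCLM ℂ (fun _ : G => H) 2 1)).comp continuous_subtype_val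

theorem groupTensor_amp {T : H →L[ℂ] H} (hT : T ∈ M.toStarSubalgebra) :
    (t.groupTensor G).τ ⟨amp G T, amp_mem hT⟩ = t.τ ⟨T, hT⟩ :=
  congrArg t.τ (Subtype.ext (entry_amp_self T 1))

end FaithfulNormalTrace

end Trace

/-! ### Exponentials of self-adjoint elements with `k ^ 3 = k` -/

section Rotation

variable {A : Type*} [Ring A] [Algebra ℂ A]

/-- The exponential `exp (i θ k)` for an element with `k ^ 3 = k`, whose power series collapses to a
quadratic polynomial in `k`. -/
def rotation (k : A) (θ : ℝ) : A :=
  1 + (Complex.cos θ - 1) • k ^ 2 + (Complex.I * Complex.sin θ) • k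

theorem rotation_zero (k : A) : rotation k 0 = 1 := by simp [rotation]

theorem continuous_rotation [TopologicalSpace A] [IsTopologicalRing A] [ContinuousSMul ℂ A]
    (k : A) : Continuous (rotation k) := by
  unfold rotation
  fun_prop

theorem _root_.Commute.rotation_right {x k : A} (h : Commute x k) (θ : ℝ) :
    Commute x (rotation k θ) :=
  ((Commute.one_right x).add_right ((h.pow_right 2).smul_right _)).add_right (h.smul_right _)

/-- The self-adjoint element with spectrum in `{-1, 0, 1}` attached to an element of order three: it
is `(i / √3) (t - t²)`. -/
def orderThreeGenerator (t : A) : A := (Complex.I / (√3 : ℝ)) • (t - t ^ 2)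

theorem sqrt_three_sq : ((√3 : ℝ) : ℂ) ^ 2 = 3 := by
  rw [← Complex.ofReal_pow, Real.sq_sqrt (by norm_num)]
  norm_num

theorem rotation_mul_rotation_neg {k : A} (hk : k ^ 3 = k) (θ : ℝ) :
    rotation k θ * rotation k (-θ) = 1 := by
  have h₁ : k * k ^ 2 = k := by rw [← pow_succ', hk]
  have h₂ : k ^ 2 * k = k := by rw [← pow_succ, hk]
  have h₃ : k ^ 2 * k ^ 2 = k ^ 2 := by nth_rw 1 [pow_two k]; rw [mul_assoc, h₁, pow_two]
  have h₄ := Complex.cos_sq_add_sin_sq θ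
  simp only [rotation, mul_add, add_mul, one_mul, mul_one, smul_mul_assoc, mul_smul_comm,
    h₁, h₂, h₃, ← pow_two, Complex.ofReal_neg, Complex.cos_neg, Complex.sin_neg]
  match_scalars
  · norm_num
  · linear_combination h₄ - Complex.sin θ ^ 2 * Complex.I_sq
  · ring

section Star

variable [StarRing A] [StarModule ℂ A] {k : A}

theorem star_rotation (hk : star k = k) (θ : ℝ) : star (rotation k θ) = rotation k (-θ) := by
  simp [rotation, hk, ← Complex.cos_conj, ← Complex.sin_conj]

theorem rotation_mem_unitary (hk : star k = k) (hk' : k ^ 3 = k) (θ : ℝ) :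
    rotation k θ ∈ unitary A := by
  rw [Unitary.mem_iff, star_rotation hk]
  exact ⟨by simpa using rotation_mul_rotation_neg hk' (-θ), rotation_mul_rotation_neg hk' θ⟩

theorem mem_of_rotation_mem (hk : star k = k) {θ : ℝ} (hθ : Real.sin θ ≠ 0) {S : Subalgebra ℂ A}
    (h : rotation k θ ∈ S) (h' : star (rotation k θ) ∈ S) : k ∈ S := by
  have hc : 2 * (Complex.I * Complex.sin θ) ≠ 0 := by
    have : Complex.sin θ ≠ 0 := by rwa [← Complex.ofReal_sin, Complex.ofReal_ne_zero]
    simp [this]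
  have : k = (2 * (Complex.I * Complex.sin θ))⁻¹ • (rotation k θ - star (rotation k θ)) := by
    rw [eq_inv_smul_iff₀ hc, star_rotation hk]
    simp only [rotation, Complex.ofReal_neg, Complex.cos_neg, Complex.sin_neg]
    module
  rw [this]
  exact S.smul_mem (S.sub_mem h h') _

theorem star_orderThreeGenerator {t : A} (ht : star t = t ^ 2) (ht' : t ^ 3 = 1) :
    star (orderThreeGenerator t) = orderThreeGenerator t := by
  have h₁ : t ^ 2 * t ^ 2 = t := by rw [← pow_add, pow_succ, ht', one_mul]
  simp only [orderThreeGenerator, star_smul, star_sub, star_pow, ht]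
  rw [pow_two (t ^ 2), h₁]
  simp only [Complex.star_def, map_div₀, Complex.conj_I, Complex.conj_ofReal]
  module

end Star

theorem orderThreeGenerator_sq {t : A} (ht' : t ^ 3 = 1) :
    orderThreeGenerator t ^ 2 = (3⁻¹ : ℂ) • (2 - t - t ^ 2) := by
  have h₀ : t * t = t ^ 2 := (pow_two t).symm
  have h₁ : t * t ^ 2 = 1 := by rw [← pow_succ', ht']
  have h₂ : t ^ 2 * t = 1 := by rw [← pow_succ, ht']
  have h₃ : t ^ 2 * t ^ 2 = t := by rw [← pow_add, pow_succ, ht', one_mul]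
  have hc : Complex.I / (√3 : ℝ) * (Complex.I / (√3 : ℝ)) = -3⁻¹ := by
    rw [div_mul_div_comm, Complex.I_mul_I, ← pow_two, sqrt_three_sq]
    norm_num
  rw [pow_two, orderThreeGenerator, smul_mul_smul_comm, hc, show (2 : A) = 1 + 1 by norm_num]
  simp only [mul_sub, sub_mul, h₀, h₁, h₂, h₃]
  module

theorem orderThreeGenerator_pow_three {t : A} (ht' : t ^ 3 = 1) :
    orderThreeGenerator t ^ 3 = orderThreeGenerator t := by
  have h₀ : t * t = t ^ 2 := (pow_two t).symm
  have h₁ : t * t ^ 2 = 1 := by rw [← pow_succ', ht']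
  have h₂ : t ^ 2 * t = 1 := by rw [← pow_succ, ht']
  have h₃ : t ^ 2 * t ^ 2 = t := by rw [← pow_add, pow_succ, ht', one_mul]
  rw [pow_succ, orderThreeGenerator_sq ht', orderThreeGenerator, smul_mul_smul_comm,
    show (2 : A) = 1 + 1 by norm_num]
  simp only [mul_sub, sub_mul, add_mul, one_mul, h₀, h₁, h₂, h₃]
  module

theorem mem_of_orderThreeGenerator_mem {t : A} (ht' : t ^ 3 = 1) {S : Subalgebra ℂ A}
    (h : orderThreeGenerator t ∈ S) : t ∈ S := by
  have h3 : ((√3 : ℝ) : ℂ) ≠ 0 := by simp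
  -- `t + t² = 2 - 3 k²` and `t - t² = -i √3 k`
  have : t = (1 : A) - (3 / 2 : ℂ) • orderThreeGenerator t ^ 2 +
      (-Complex.I * (√3 : ℝ) / 2) • orderThreeGenerator t := by
    have hc : -Complex.I * (√3 : ℝ) / 2 * (Complex.I / (√3 : ℝ)) = 1 / 2 := by
      field_simp
      rw [Complex.I_sq]
      norm_num
    rw [orderThreeGenerator_sq ht', orderThreeGenerator, smul_smul, smul_smul, hc,
      show (2 : A) = 1 + 1 by norm_num]
    module
  rw [this]
  exact S.add_mem (S.sub_mem S.one_mem (S.smul_mem (S.pow_mem h 2) _)) (S.smul_mem h _)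

end Rotation

/-! ### A paradox that excludes invariant states -/

section Amenable

variable {B : Type*} [Ring B] [Algebra ℂ B]

/-- The centralizer of a linear functional `φ` within a subalgebra `S`: the elements `X` of `S` with
`φ (X T) = φ (T X)` for all `T` in `S`. -/
def functionalCentralizer (S : Subalgebra ℂ B) (φ : B →ₗ[ℂ] ℂ) : Subalgebra ℂ B where
  carrier := {X | X ∈ S ∧ ∀ T ∈ S, φ (X * T) = φ (T * X)}
  mul_mem' := fun {X Y} hX hY => ⟨S.mul_mem hX.1 hY.1, fun T hT => by
    rw [mul_assoc, hX.2 _ (S.mul_mem hY.1 hT), mul_assoc, hY.2 _ (S.mul_mem hT hX.1), mul_assoc]⟩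
  add_mem' := fun {X Y} hX hY => ⟨S.add_mem hX.1 hY.1, fun T hT => by
    rw [add_mul, mul_add, map_add, map_add, hX.2 T hT, hY.2 T hT]⟩
  algebraMap_mem' := fun c => ⟨S.algebraMap_mem c, fun T _ => by rw [Algebra.commutes]⟩

/-- A subset `A` of `G` and elements `s`, `t` of orders two and three such that `A` and `s A`
partition `G`, and so do `A`, `t A` and `t² A`. An invariant mean would give `A` the measure `1/2`
and the measure `1/3`. -/
structure IsTwoThreeParadox {G : Type w} [Group G] (s t : G) (A : Set G) : Prop where
  sq : s ^ 2 = 1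
  cube : t ^ 3 = 1
  mem_two : ∀ x, s * x ∈ A ↔ x ∉ A
  mem_three : ∀ x, (x ∈ A ∧ t * x ∉ A ∧ t ^ 2 * x ∉ A) ∨ (x ∉ A ∧ t * x ∈ A ∧ t ^ 2 * x ∉ A) ∨
    (x ∉ A ∧ t * x ∉ A ∧ t ^ 2 * x ∈ A)

/-- The permutation of `ℕ` that exchanges `2 n` and `2 n + 1`. -/
def swapParity : Equiv.Perm ℕ where
  toFun n := if n % 2 = 0 then n + 1 else n - 1
  invFun n := if n % 2 = 0 then n + 1 else n - 1
  left_inv n := by grind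
  right_inv n := by grind

/-- The permutation of `ℕ` with the cycles `2 n ↦ 4 n + 1 ↦ 4 n + 3 ↦ 2 n`. -/
def cycleThree : Equiv.Perm ℕ where
  toFun n := if n % 2 = 0 then 2 * n + 1 else if n % 4 = 1 then n + 2 else (n - 3) / 2
  invFun n := if n % 2 = 0 then 2 * n + 3 else if n % 4 = 1 then (n - 1) / 2 else n - 2
  left_inv n := by grind
  right_inv n := by grind

theorem isTwoThreeParadox_perm :
    IsTwoThreeParadox swapParity cycleThree {g : Equiv.Perm ℕ | g 0 % 2 = 0} where
  sq := by
    ext n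
    simp only [pow_two, Equiv.Perm.mul_apply, swapParity, Equiv.coe_fn_mk, Equiv.Perm.one_apply]
    grind
  cube := by
    ext n
    simp only [pow_succ, pow_zero, one_mul, Equiv.Perm.mul_apply, cycleThree, Equiv.coe_fn_mk,
      Equiv.Perm.one_apply]
    grind
  mem_two g := by
    simp only [Set.mem_ofPred_eq, Equiv.Perm.mul_apply, swapParity, Equiv.coe_fn_mk]
    grind
  mem_three g := by
    simp only [Set.mem_ofPred_eq, pow_two, Equiv.Perm.mul_apply, cycleThree, Equiv.coe_fn_mk]
    grind

variable {G : Type w} [Group G] {s t : G} {A : Set G} {H : Type u} [NormedAddCommGroup H]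
  [InnerProductSpace ℂ H]

theorem IsTwoThreeParadox.shift_mul_cutoff_mul_shift (h : IsTwoThreeParadox s t A) :
    shift H (Equiv.mulLeft s) * (cutoff H A * shift H (Equiv.mulLeft s)) = 1 - cutoff H A := by
  classical
  have hs : s⁻¹ = s := inv_eq_of_mul_eq_one_left (by rw [← pow_two, h.sq])
  ext ξ x
  have := h.mem_two x
  have h2 : s * (s * x) = x := by rw [← mul_assoc, ← pow_two, h.sq, one_mul]
  by_cases hx : x ∈ A <;> simp_all [cutoff_apply]

theorem IsTwoThreeParadox.sum_shift_mul_cutoff_mul_shift (h : IsTwoThreeParadox s t A) :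
    cutoff H A + shift H (Equiv.mulLeft t) * (cutoff H A * shift H (Equiv.mulLeft (t ^ 2))) +
      shift H (Equiv.mulLeft (t ^ 2)) * (cutoff H A * shift H (Equiv.mulLeft t)) = 1 := by
  classical
  have ht : t⁻¹ = t ^ 2 := inv_eq_of_mul_eq_one_left (by rw [← pow_succ, h.cube])
  have ht' : (t ^ 2)⁻¹ = t := by rw [← ht, inv_inv]
  ext ξ x
  have h2 : t * (t ^ 2 * x) = x := by rw [← mul_assoc, ← pow_succ', h.cube, one_mul]
  have h3 : t ^ 2 * (t * x) = x := by rw [← mul_assoc, ← pow_succ, h.cube, one_mul]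
  rcases h.mem_three x with hx | hx | hx <;>
    simp [cutoff_apply, ht, ht', h2, h3, hx]

/-- No linear functional with value one at the identity is central for the translation operators by
`s` and `t`. -/
theorem IsTwoThreeParadox.shift_notMem_functionalCentralizer (h : IsTwoThreeParadox s t A)
    {S : Subalgebra ℂ (Ell2 G H →L[ℂ] Ell2 G H)} (hS : cutoff H A ∈ S)
    {φ : (Ell2 G H →L[ℂ] Ell2 G H) →ₗ[ℂ] ℂ} (hφ : φ 1 = 1)
    (hs : shift H (Equiv.mulLeft s) ∈ functionalCentralizer S φ) :
    shift H (Equiv.mulLeft t) ∉ functionalCentralizer S φ := by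
  intro ht
  have ht2 : shift H (Equiv.mulLeft (t ^ 2)) ∈ functionalCentralizer S φ := by
    rw [pow_two, shift_mulLeft_mul]
    exact mul_mem ht ht
  have h₁ := congrArg φ (h.shift_mul_cutoff_mul_shift (H := H))
  rw [hs.2 _ (S.mul_mem hS hs.1), mul_assoc, ← shift_mulLeft_mul, ← pow_two, h.sq, shift_mulLeft_one,
    mul_one, map_sub, hφ] at h₁
  have h₂ := congrArg φ (h.sum_shift_mul_cutoff_mul_shift (H := H))
  rw [map_add, map_add, ht.2 _ (S.mul_mem hS ht2.1), ht2.2 _ (S.mul_mem hS ht.1), mul_assoc,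
    mul_assoc, ← shift_mulLeft_mul, ← shift_mulLeft_mul, ← pow_succ, ← pow_succ', h.cube,
    shift_mulLeft_one, mul_one, hφ] at h₂
  -- `φ (cutoff H A)` is `1/2` by `h₁` and `1/3` by `h₂`
  have h₃ : (1 : ℂ) = 0 := by linear_combination 2 * h₂ - 3 * h₁
  exact one_ne_zero h₃

/-- A tensor product `π ⊗ σ` is not amenable if the algebra generated by `σ` contains the
translations by elements `s` and `t` as in `IsTwoThreeParadox`: an invariant state on `B(H ⊗ ℓ² G)`
is central for `σ` on the commutant of `π ⊗ 1`. -/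
theorem IsTwoThreeParadox.not_isAmenableRep [CompleteSpace H] (h : IsTwoThreeParadox s t A)
    {Γ : Type v} [Group Γ]
    (π : Γ →* unitary (H →L[ℂ] H)) (σ ρ : Γ →* unitary (Ell2 G H →L[ℂ] Ell2 G H))
    (hρ : ∀ g, (ρ g : Ell2 G H →L[ℂ] Ell2 G H) = amp G (π g : H →L[ℂ] H) * σ g)
    (hσ : ∀ g k, Commute (amp G (π g : H →L[ℂ] H)) (σ k : Ell2 G H →L[ℂ] Ell2 G H))
    (hs : shift H (Equiv.mulLeft s) ∈
      Algebra.adjoin ℂ (Set.range fun g => (σ g : Ell2 G H →L[ℂ] Ell2 G H)))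
    (ht : shift H (Equiv.mulLeft t) ∈
      Algebra.adjoin ℂ (Set.range fun g => (σ g : Ell2 G H →L[ℂ] Ell2 G H))) :
    ¬ IsAmenableRep ρ := by
  rintro ⟨φ, -, hφ, hinv⟩
  let S : Subalgebra ℂ (Ell2 G H →L[ℂ] Ell2 G H) :=
    Subalgebra.centralizer ℂ (Set.range fun g => amp G (π g : H →L[ℂ] H))
  have hS : ∀ {T}, T ∈ S ↔ ∀ g, amp G (π g : H →L[ℂ] H) * T = T * amp G (π g : H →L[ℂ] H) := by
    intro T
    simp [S, Subalgebra.mem_centralizer_iff]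
  have hle : Algebra.adjoin ℂ (Set.range fun g => (σ g : Ell2 G H →L[ℂ] Ell2 G H)) ≤
      functionalCentralizer S φ := by
    refine Algebra.adjoin_le ?_
    rintro _ ⟨k, rfl⟩
    have hk : (σ k : Ell2 G H →L[ℂ] Ell2 G H) ∈ S := hS.2 fun g => hσ g k
    refine ⟨hk, fun T hT => ?_⟩
    -- apply invariance under `ρ k` to `T σ(k)`
    rw [← hinv k (T * σ k), hρ, star_mul, star_amp]
    congr 1
    have h₁ : (σ k : Ell2 G H →L[ℂ] Ell2 G H) * star (σ k : Ell2 G H →L[ℂ] Ell2 G H) = 1 :=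
      Unitary.mul_star_self_of_mem (σ k).2
    have h₂ : amp G (π k : H →L[ℂ] H) * amp G (star (π k : H →L[ℂ] H)) = 1 := by
      rw [← amp_mul, Unitary.mul_star_self_of_mem (π k).2, amp_one]
    calc (σ k : Ell2 G H →L[ℂ] Ell2 G H) * T
        = (σ k * T) * (amp G (π k : H →L[ℂ] H) * amp G (star (π k : H →L[ℂ] H))) := by
          rw [h₂, mul_one]
      _ = amp G (π k : H →L[ℂ] H) * (σ k * T) * amp G (star (π k : H →L[ℂ] H)) := by
          rw [← mul_assoc, ← hS.1 (S.mul_mem hk hT) k]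
      _ = _ := by
          simp only [mul_assoc]
          rw [← mul_assoc (σ k : Ell2 G H →L[ℂ] Ell2 G H) (star _), h₁, one_mul]
  exact h.shift_notMem_functionalCentralizer (hS.2 fun g => amp_mul_cutoff _ _) hφ (hle hs)
    (hle ht)

end Amenable

/-! ### Free quotients -/

section FreeQuotient

/-- A group with a non-abelian free quotient maps onto a free group with two distinct generators. -/
theorem exists_surjective_freeGroup {Γ : Type v} [Group Γ]
    (hΓ : ∃ (N : Subgroup Γ) (_ : N.Normal), IsFreeGroup (Γ ⧸ N) ∧ ∃ x y : Γ ⧸ N, x * y ≠ y * x) :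
    ∃ (X : Type v) (f : Γ →* FreeGroup X) (x y : X), Function.Surjective f ∧ x ≠ y := by
  obtain ⟨N, _, ⟨X, ⟨b⟩⟩, a, c, hac⟩ := hΓ
  have hX : Nontrivial X := by
    by_contra hX
    rw [not_nontrivial_iff_subsingleton] at hX
    refine hac (b.repr.injective ?_)
    rw [map_mul, map_mul]
    cases isEmpty_or_nonempty X
    · exact Subsingleton.elim _ _
    · have : Unique X := uniqueOfSubsingleton (Classical.arbitrary X)
      exact (FreeGroup.mulEquivIntOfUnique (α := X)).injective (by
        rw [map_mul, map_mul, mul_comm])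
  obtain ⟨x, y, hxy⟩ := exists_pair_ne X
  exact ⟨X, b.repr.toMonoidHom.comp (QuotientGroup.mk' N), x, y,
    b.repr.surjective.comp (QuotientGroup.mk'_surjective N), hxy⟩

end FreeQuotient

/-! ### Homomorphisms into unitary groups of tracial von Neumann algebras -/

section Perturbation

variable {Γ : Type v} [Group Γ] {H : Type u} [NormedAddCommGroup H] [InnerProductSpace ℂ H]
  [CompleteSpace H]

theorem repVonNeumann_le (π : Γ →* unitary (H →L[ℂ] H)) {M : VonNeumannAlgebra H}
    (h : ∀ g, (π g : H →L[ℂ] H) ∈ M.toStarSubalgebra) :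
    (repVonNeumann π).toStarSubalgebra ≤ M.toStarSubalgebra := by
  intro T hT
  change T ∈ M
  rw [← M.commutant_commutant, VonNeumannAlgebra.mem_commutant_iff]
  intro z hz
  refine VonNeumannAlgebra.mem_commutant_iff.1 (show T ∈ (repCommutant π).commutant from hT) z ?_
  change z ∈ StarSubalgebra.centralizer ℂ _
  rw [StarSubalgebra.mem_centralizer_iff]
  rintro _ ⟨g, rfl⟩
  exact ⟨VonNeumannAlgebra.mem_commutant_iff.1 hz _ (h g),
    VonNeumannAlgebra.mem_commutant_iff.1 hz _ (star_mem (h g))⟩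

/-- The inclusion of the unitary group of `M` into that of `B(H)`. -/
def unitaryInclusion (M : VonNeumannAlgebra H) :
    unitary M.toStarSubalgebra →* unitary (H →L[ℂ] H) :=
  (Unitary.map (R := M.toStarSubalgebra) (S := H →L[ℂ] H)
    { toFun := Subtype.val
      map_one' := rfl
      map_mul' := fun _ _ => rfl
      map_star' := fun _ => rfl }).toMonoidHom

theorem norm_coe_unitary_le_one {M : VonNeumannAlgebra H} (u : unitary M.toStarSubalgebra) :
    ‖((u : M.toStarSubalgebra) : H →L[ℂ] H)‖ ≤ 1 := by
  have h := CStarRing.norm_star_mul_self (x := ((u : M.toStarSubalgebra) : H →L[ℂ] H))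
  have h₁ : star ((u : M.toStarSubalgebra) : H →L[ℂ] H) * (u : M.toStarSubalgebra) = 1 :=
    Unitary.star_mul_self_of_mem (unitaryInclusion M u).2
  rw [h₁] at h
  have h₂ : ‖(1 : H →L[ℂ] H)‖ ≤ 1 := ContinuousLinearMap.norm_id_le
  nlinarith [norm_nonneg ((u : M.toStarSubalgebra) : H →L[ℂ] H)]

/-- The tracial representation given by a homomorphism into the unitary group of a tracial von
Neumann algebra. -/
def TracialRep.ofHom {M : VonNeumannAlgebra H} (t : FaithfulNormalTrace M)
    (b : Γ →* unitary M.toStarSubalgebra) : TracialRep.{u} Γ where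
  H := H
  π := (unitaryInclusion M).comp b
  trace := t.restrict (repVonNeumann_le _ fun g => (b g).1.2)

variable {G : Type w} [Group G] {M : VonNeumannAlgebra H}

/-- The amplification of a homomorphism into the unitary group of `M`. -/
def ampHom (G : Type w) [Group G] (π : Γ →* unitary (H →L[ℂ] H))
    (h : ∀ g, (π g : H →L[ℂ] H) ∈ M.toStarSubalgebra) :
    Γ →* unitary (groupTensor G M).toStarSubalgebra :=
  MonoidHom.mk' (fun g => ⟨⟨amp G (π g : H →L[ℂ] H), amp_mem (h g)⟩, by
    rw [Unitary.mem_iff]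
    constructor <;> refine Subtype.ext ?_
    · change star (amp G (π g : H →L[ℂ] H)) * amp G (π g : H →L[ℂ] H) = 1
      rw [star_amp, ← amp_mul, Unitary.star_mul_self_of_mem (π g).2, amp_one]
    · change amp G (π g : H →L[ℂ] H) * star (amp G (π g : H →L[ℂ] H)) = 1
      rw [star_amp, ← amp_mul, Unitary.mul_star_self_of_mem (π g).2, amp_one]⟩)
    fun g k => by
      refine Subtype.ext (Subtype.ext ?_)
      change amp G (π (g * k) : H →L[ℂ] H) = amp G (π g : H →L[ℂ] H) * amp G (π k : H →L[ℂ] H)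
      rw [map_mul, ← amp_mul]
      rfl

end Perturbation

/-! ### Representations of free groups near the trivial one -/

section FreePerturbation

variable {A : Type*} [Ring A] [StarRing A] [Algebra ℂ A] [StarModule ℂ A] {X : Type v} {k : X → A}

/-- The representation of the free group that sends the generator `x` to the unitary
`exp (i θ k x)`, where each `k x` is self-adjoint with `(k x) ^ 3 = k x`. -/
def rotationHom (hk : ∀ x, star (k x) = k x) (hk' : ∀ x, k x ^ 3 = k x) (θ : ℝ) :
    FreeGroup X →* unitary A :=
  FreeGroup.lift fun x => ⟨rotation (k x) θ, rotation_mem_unitary (hk x) (hk' x) θ⟩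

variable (hk : ∀ x, star (k x) = k x) (hk' : ∀ x, k x ^ 3 = k x)

theorem coe_rotationHom_of (θ : ℝ) (x : X) :
    (rotationHom hk hk' θ (FreeGroup.of x) : A) = rotation (k x) θ := by
  simp [rotationHom]

theorem commute_rotationHom {a : A} (h : ∀ x, Commute a (k x)) (h' : ∀ x, Commute (star a) (k x))
    (θ : ℝ) (w : FreeGroup X) : Commute a (rotationHom hk hk' θ w : A) := by
  induction w using FreeGroup.induction_on with
  | C1 => simp
  | of x => rw [coe_rotationHom_of]; exact (h x).rotation_right θ
  | inv_of x _ =>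
    rw [map_inv, ← Unitary.star_eq_inv, Unitary.coe_star, coe_rotationHom_of, ← star_star a,
      Commute, SemiconjBy, ← star_mul, ← star_mul, ((h' x).rotation_right θ).eq]
  | mul x y hx hy => rw [map_mul, Submonoid.coe_mul]; exact hx.mul_right hy

theorem tendsto_rotationHom [TopologicalSpace A] [IsTopologicalRing A] [ContinuousSMul ℂ A]
    [ContinuousStar A] (w : FreeGroup X) :
    Tendsto (fun θ => (rotationHom hk hk' θ w : A)) (𝓝 0) (𝓝 1) := by
  induction w using FreeGroup.induction_on with
  | C1 => simpa using tendsto_const_nhds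
  | of x =>
    simp only [coe_rotationHom_of]
    exact (continuous_rotation (k x)).tendsto' 0 1 (rotation_zero _)
  | inv_of x h =>
    simpa only [map_inv, ← Unitary.star_eq_inv, Unitary.coe_star, star_one] using h.star
  | mul x y hx hy => simpa only [map_mul, Submonoid.coe_mul, mul_one] using hx.mul hy

end FreePerturbation

/-! ### Left translations -/

section Translation

variable {G : Type w} [Group G] {H : Type u} [NormedAddCommGroup H] [InnerProductSpace ℂ H]
  [CompleteSpace H]

/-- The left translations, as elements of `groupTensor G M`. -/
def leftTranslation (M : VonNeumannAlgebra H) : G →* (groupTensor G M).toStarSubalgebra where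
  toFun s := ⟨shift H (Equiv.mulLeft s), shift_mulLeft_mem s⟩
  map_one' := Subtype.ext shift_mulLeft_one
  map_mul' s t := Subtype.ext (shift_mulLeft_mul s t)

theorem coe_leftTranslation (M : VonNeumannAlgebra H) (s : G) :
    (leftTranslation M s : Ell2 G H →L[ℂ] Ell2 G H) = shift H (Equiv.mulLeft s) := rfl

theorem star_leftTranslation (M : VonNeumannAlgebra H) (s : G) :
    star (leftTranslation M s) = leftTranslation M s⁻¹ := by
  have : (Equiv.mulLeft s)⁻¹ = Equiv.mulLeft s⁻¹ := by ext; simp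
  refine Subtype.ext ?_
  rw [StarMemClass.coe_star, coe_leftTranslation, coe_leftTranslation, star_shift, this]

end Translation

/-! ### Perturbing a tracial representation -/

section Density

variable {Γ : Type v} [Group Γ] {G : Type} [Group G] {s t : G} {A : Set G}

open Classical in
/-- The self-adjoint elements whose exponentials perturb a representation: one generator uses the
translation by `s`, all others the translation by `t`. -/
def perturbationGenerator {H : Type u} [NormedAddCommGroup H] [InnerProductSpace ℂ H]
    [CompleteSpace H] (M : VonNeumannAlgebra H) (s t : G) {X : Type v} (x z : X) :
    (groupTensor G M).toStarSubalgebra :=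
  if z = x then leftTranslation M s else orderThreeGenerator (leftTranslation M t)

variable {H : Type u} [NormedAddCommGroup H] [InnerProductSpace ℂ H] [CompleteSpace H]
  (M : VonNeumannAlgebra H) {X : Type v} (x : X)

theorem commute_amp_perturbationGenerator {T : H →L[ℂ] H} (hT : T ∈ M.toStarSubalgebra) (z : X) :
    Commute (⟨amp G T, amp_mem hT⟩ : (groupTensor G M).toStarSubalgebra)
      (perturbationGenerator M s t x z) := by
  have hcomm : ∀ r : G, Commute (⟨amp G T, amp_mem hT⟩ : (groupTensor G M).toStarSubalgebra)
      (leftTranslation M r) := fun r => Subtype.ext <| by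
    rw [MulMemClass.coe_mul, MulMemClass.coe_mul, coe_leftTranslation, amp_mul_shift]
  unfold perturbationGenerator
  split_ifs
  · exact hcomm s
  · exact ((hcomm t).sub_right ((hcomm t).pow_right 2)).smul_right _

namespace IsTwoThreeParadox

theorem leftTranslation_cube (h : IsTwoThreeParadox s t A) : leftTranslation M t ^ 3 = 1 := by
  rw [← map_pow, h.cube, map_one]

theorem star_perturbationGenerator (h : IsTwoThreeParadox s t A) (z : X) :
    star (perturbationGenerator M s t x z) = perturbationGenerator M s t x z := by
  unfold perturbationGenerator
  split_ifs
  · rw [star_leftTranslation, inv_eq_of_mul_eq_one_left (by rw [← pow_two, h.sq])]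
  · refine star_orderThreeGenerator ?_ (h.leftTranslation_cube M)
    rw [star_leftTranslation, inv_eq_of_mul_eq_one_left (by rw [← pow_succ, h.cube]), map_pow]

theorem perturbationGenerator_cube (h : IsTwoThreeParadox s t A) (z : X) :
    perturbationGenerator M s t x z ^ 3 = perturbationGenerator M s t x z := by
  unfold perturbationGenerator
  split_ifs
  · rw [← map_pow, pow_succ, h.sq, one_mul]
  · exact orderThreeGenerator_pow_three (h.leftTranslation_cube M)

end IsTwoThreeParadox

/-- The representation of the free group by the exponentials of `i θ` times the elements
`perturbationGenerator M s t x z`. -/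
def freePerturbation (h : IsTwoThreeParadox s t A) (θ : ℝ) :
    FreeGroup X →* unitary (groupTensor G M).toStarSubalgebra :=
  rotationHom (h.star_perturbationGenerator M x) (h.perturbationGenerator_cube M x) θ

theorem star_mk_amp {T : H →L[ℂ] H} (hT : T ∈ M.toStarSubalgebra) :
    star (⟨amp G T, amp_mem hT⟩ : (groupTensor G M).toStarSubalgebra) =
      ⟨amp G (star T), amp_mem (star_mem hT)⟩ :=
  Subtype.ext (star_amp T)

theorem commute_amp_freePerturbation (h : IsTwoThreeParadox s t A) {T : H →L[ℂ] H}
    (hT : T ∈ M.toStarSubalgebra) (θ : ℝ) (w : FreeGroup X) :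
    Commute (⟨amp G T, amp_mem hT⟩ : (groupTensor G M).toStarSubalgebra)
      (freePerturbation M x h θ w : (groupTensor G M).toStarSubalgebra) := by
  have h₁ : ∀ z : X, Commute (⟨amp G T, amp_mem hT⟩ : (groupTensor G M).toStarSubalgebra)
      (perturbationGenerator M s t x z) := commute_amp_perturbationGenerator M x hT
  have h₂ : ∀ z : X, Commute (star (⟨amp G T, amp_mem hT⟩ : (groupTensor G M).toStarSubalgebra))
      (perturbationGenerator M s t x z) := fun z => by
    rw [star_mk_amp M hT]
    exact commute_amp_perturbationGenerator M x (star_mem hT) z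
  exact commute_rotationHom (h.star_perturbationGenerator M x) (h.perturbationGenerator_cube M x)
    h₁ h₂ θ w

theorem commute_ampHom_freePerturbation (h : IsTwoThreeParadox s t A)
    (π : Γ →* unitary (H →L[ℂ] H)) (hπ : ∀ g, (π g : H →L[ℂ] H) ∈ M.toStarSubalgebra) (θ : ℝ)
    (g : Γ) (w : FreeGroup X) : Commute (ampHom G π hπ g) (freePerturbation M x h θ w) :=
  Subtype.ext (commute_amp_freePerturbation M x h (hπ g) θ w).eq

/-- The tensor product of a tracial representation with the representation of the free group `F(X)`
given by the unitaries `exp (i θ k)` in the group von Neumann algebra of `G`, pulled back along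
`f : Γ → F(X)`. -/
def perturbedHom (h : IsTwoThreeParadox s t A) (p : TracialRep.{u} Γ) (f : Γ →* FreeGroup X)
    (θ : ℝ) : Γ →* unitary (groupTensor G (repVonNeumann p.π)).toStarSubalgebra :=
  ((ampHom G p.π (mem_repVonNeumann p.π)).noncommCoprod
    (freePerturbation (repVonNeumann p.π) x h θ)
    (commute_ampHom_freePerturbation _ x h p.π (mem_repVonNeumann p.π) θ)).comp
    ((MonoidHom.id Γ).prod f)

/-- The common realization of `p` and of its perturbation in the tensor product of `M_p` with the
group von Neumann algebra of `G`. -/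
def perturbedRealization (h : IsTwoThreeParadox s t A) (p : TracialRep.{u} Γ)
    (f : Γ →* FreeGroup X) (θ : ℝ) :
    CommonRealization p (.ofHom (p.trace.groupTensor G) (perturbedHom x h p f θ)) where
  K := Ell2 G p.H
  M := groupTensor G (repVonNeumann p.π)
  trace := p.trace.groupTensor G
  a := ampHom G p.π (mem_repVonNeumann p.π)
  b := perturbedHom x h p f θ
  trace_a _ := p.trace.groupTensor_amp _
  trace_b _ := rfl

theorem tendsto_perturbedHom (h : IsTwoThreeParadox s t A) (p : TracialRep.{u} Γ)
    (f : Γ →* FreeGroup X) (g : Γ) :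
    Tendsto (fun θ => (p.trace.groupTensor G).norm₂
      ((ampHom G p.π (mem_repVonNeumann p.π) g :
        (groupTensor G (repVonNeumann p.π)).toStarSubalgebra) - perturbedHom x h p f θ g)) (𝓝 0) (𝓝 0) := by
  -- the difference tends to zero in norm, so normality of the trace applies to its absolute square
  set t := p.trace.groupTensor G
  set a := ampHom G p.π (mem_repVonNeumann p.π) g
  let D : ℝ → (groupTensor G (repVonNeumann p.π)).toStarSubalgebra :=
    fun θ => (a : (groupTensor G (repVonNeumann p.π)).toStarSubalgebra) - perturbedHom x h p f θ g
  have hD : Tendsto D (𝓝 0) (𝓝 0) := by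
    have := (tendsto_rotationHom (h.star_perturbationGenerator (repVonNeumann p.π) x)
      (h.perturbationGenerator_cube (repVonNeumann p.π) x) (f g)).const_mul
      (a : (groupTensor G (repVonNeumann p.π)).toStarSubalgebra)
    simpa using! this.const_sub (a : (groupTensor G (repVonNeumann p.π)).toStarSubalgebra)
  have hDD : Tendsto (fun θ => star (D θ) * D θ) (𝓝 0) (𝓝 0) := by
    simpa using hD.star.mul hD
  have hle : ∀ θ, ‖(D θ : Ell2 G p.H →L[ℂ] Ell2 G p.H)‖ ≤ 2 := fun θ => by
    refine (norm_sub_le _ _).trans ?_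
    have h₁ := norm_coe_unitary_le_one a
    have h₂ := norm_coe_unitary_le_one (perturbedHom x h p f θ g)
    exact (add_le_add h₁ h₂).trans (by norm_num)
  have := t.tendsto (A := fun θ => star (D θ) * D θ) (B := 0) (C := 2 * 2) (l := 𝓝 0) (fun θ => by
    refine (norm_mul_le _ _).trans ?_
    change ‖star (D θ : Ell2 G p.H →L[ℂ] Ell2 G p.H)‖ * _ ≤ _
    rw [norm_star]
    exact mul_le_mul (hle θ) (hle θ) (norm_nonneg _) (by norm_num)) fun ξ =>
      ((ContinuousLinearMap.apply ℂ (Ell2 G p.H) ξ).continuous.tendsto _).comp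
        ((continuous_subtype_val.tendsto _).comp hDD)
  have h0 := ((Complex.continuous_re.tendsto _).comp this).sqrt
  simpa using! h0

theorem tendsto_wasserstein_perturbedHom (h : IsTwoThreeParadox s t A) (p : TracialRep.{u} Γ)
    (f : Γ →* FreeGroup X) (S : Finset Γ) :
    Tendsto (fun θ => wasserstein S p
      (.ofHom (p.trace.groupTensor G) (perturbedHom x h p f θ))) (𝓝 0) (𝓝 0) := by
  have h₁ : Tendsto (fun θ => ENNReal.ofReal (√(∑ g ∈ S, (p.trace.groupTensor G).norm₂
      ((ampHom G p.π (mem_repVonNeumann p.π) g :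
        (groupTensor G (repVonNeumann p.π)).toStarSubalgebra) -
        perturbedHom x h p f θ g) ^ 2))) (𝓝 0) (𝓝 0) := by
    have := ENNReal.tendsto_ofReal (tendsto_finsetSum S fun g _ =>
      (tendsto_perturbedHom x h p f g).pow 2).sqrt
    simpa using this
  exact tendsto_of_tendsto_of_tendsto_of_le_of_le tendsto_const_nhds h₁ (fun _ => zero_le)
    fun θ => iInf_le _ (perturbedRealization x h p f θ)

theorem not_isAmenable_perturbedHom (h : IsTwoThreeParadox s t A) (p : TracialRep.{u} Γ)
    {f : Γ →* FreeGroup X} (hf : Function.Surjective f) {y : X} (hxy : y ≠ x) {θ : ℝ}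
    (hθ : Real.sin θ ≠ 0) :
    ¬ (TracialRep.ofHom (p.trace.groupTensor G) (perturbedHom x h p f θ)).IsAmenable := by
  let σ := (unitaryInclusion (groupTensor G (repVonNeumann p.π))).comp
    ((freePerturbation (repVonNeumann p.π) x h θ).comp f)
  have hmem : ∀ z, (perturbationGenerator (repVonNeumann p.π) s t x z :
      Ell2 G p.H →L[ℂ] Ell2 G p.H) ∈
      Algebra.adjoin ℂ (Set.range fun g => (σ g : Ell2 G p.H →L[ℂ] Ell2 G p.H)) := by
    intro z
    obtain ⟨g, hg⟩ := hf (FreeGroup.of z)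
    have hσ : (σ g : Ell2 G p.H →L[ℂ] Ell2 G p.H) =
        rotation (perturbationGenerator (repVonNeumann p.π) s t x z :
          Ell2 G p.H →L[ℂ] Ell2 G p.H) θ := by
      change ((freePerturbation (repVonNeumann p.π) x h θ (f g) :
        (groupTensor G (repVonNeumann p.π)).toStarSubalgebra) : Ell2 G p.H →L[ℂ] Ell2 G p.H) = _
      rw [hg, freePerturbation, coe_rotationHom_of]
      rfl
    refine mem_of_rotation_mem
      (congrArg Subtype.val (h.star_perturbationGenerator (repVonNeumann p.π) x z)) hθ ?_ ?_
    · exact hσ ▸ Algebra.subset_adjoin ⟨g, rfl⟩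
    · rw [← hσ, ← Unitary.coe_star, Unitary.star_eq_inv, ← map_inv]
      exact Algebra.subset_adjoin ⟨g⁻¹, rfl⟩
  refine h.not_isAmenableRep p.π σ _ (fun g => rfl) (fun g k => ?_) ?_ ?_
  · exact congrArg (fun u : unitary (groupTensor G (repVonNeumann p.π)).toStarSubalgebra =>
      ((u : (groupTensor G (repVonNeumann p.π)).toStarSubalgebra) :
        Ell2 G p.H →L[ℂ] Ell2 G p.H)) (commute_ampHom_freePerturbation _ x h p.π
        (mem_repVonNeumann p.π) θ g (f k)).eq
  · have := hmem x
    rwa [perturbationGenerator, if_pos rfl] at this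
  · have := hmem y
    rw [perturbationGenerator, if_neg hxy] at this
    refine mem_of_orderThreeGenerator_mem ?_ this
    exact congrArg Subtype.val (h.leftTranslation_cube (repVonNeumann p.π))

end Density

end TracialReps
end

theorem proposition3 {Γ : Type v} [Group Γ] [Countable Γ]
    (hΓ : ∃ (N : Subgroup Γ) (_ : N.Normal), IsFreeGroup (Γ ⧸ N) ∧ ∃ x y : Γ ⧸ N, x * y ≠ y * x) :
    Dense {p : TracialReps.TracialRep.{u} Γ | ¬ p.IsAmenable} ∧
    ∀ (p : TracialReps.TracialRep.{u} Γ) (S : Finset Γ) (ε : ENNReal), 0 < ε →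
      ∃ q : TracialReps.TracialRep.{u} Γ, ¬ q.IsAmenable ∧ TracialReps.wasserstein S p q < ε := by
  have key : ∀ (p : TracialReps.TracialRep.{u} Γ) (S : Finset Γ) (ε : ENNReal), 0 < ε →
      ∃ q : TracialReps.TracialRep.{u} Γ, ¬ q.IsAmenable ∧ TracialReps.wasserstein S p q < ε := by
    intro p S ε hε
    obtain ⟨X, f, x, y, hf, hxy⟩ := TracialReps.exists_surjective_freeGroup hΓ
    have hsmall := (TracialReps.tendsto_wasserstein_perturbedHom x
      TracialReps.isTwoThreeParadox_perm p f S).eventually (gt_mem_nhds hε)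
    obtain ⟨θ, ⟨hθ₀, hθπ⟩, hθ⟩ :=
      ((Filter.eventually_mem_set.2 (Ioo_mem_nhdsGT Real.pi_pos)).and
        (hsmall.filter_mono nhdsWithin_le_nhds)).exists
    -- a small angle in `(0, π)` has non-zero sine
    exact ⟨_, TracialReps.not_isAmenable_perturbedHom x _ p hf hxy.symm
      (Real.sin_pos_of_pos_of_lt_pi hθ₀ hθπ).ne', hθ⟩
  refine ⟨fun p => mem_closure_iff.2 fun U hU hp => ?_, key⟩
  obtain ⟨S, ε, hε, hS⟩ := hU p hp
  obtain ⟨q, hq, hpq⟩ := key p S ε hε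
  exact ⟨q, hS q hpq, hq⟩
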